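/- Let $d\ge 1$, $0<\beta<d$, and for $f$ on $\mathbb R^d$ (real- or complex-valued) put $$\mathcal G_\beta f(x)=\int_{\mathbb R^d}|x-y|^{-\beta}f(y)\,dy .$$ For $1<r<\infty$ let $\|g\|^*_{r,\infty}=\sup_{\lambda>0}\lambda\,|\{x:|g(x)|>\lambda\}|^{1/r}$, and for $r'=r/(r-1)$ let $$\|f\|_{r,1}=\sup\Big\{\int_{\mathbb R^d}|fg|\,dx \;:\; g \text{ measurable},\ \|g\|^*_{r',\infty}\le 1\Big\}$$ be the Lorentz $L_{r,1}$ norm. For $s>d$ set $$|\!|\!|f|\!|\!|_{\beta,s}=\int_{\mathbb R^d}(1+|x|)^{s-d}|f(x)|\,dx+\sup_{R>0}(1+R)^{\beta+s-d}\,\|f_{>R}\|_{d/(d-\beta),1},$$ where $f_{>R}=f\,\mathbf 1_{\{|x|>R\}}$, and let $\mathcal L_{\beta,s}$ be the space of all measurable $f$ with $|\!|\!|f|\!|\!|_{\beta,s}<\infty$. **Theorem.** Let $d<s\le d+1$ and let $q$ satisfy $$\frac{d}{\beta+s-d}<q\le\frac d\beta .$$ (i) There is a constant $C$ depending only on $d,q,s,\beta$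 such that for every $f\in\mathcal L_{\beta,s}$ with $\int_{\mathbb R^d}f\,dx=0$, the integral defining $\mathcal G_\beta f(x)$ converges absolutely for almost every $x$, $\mathcal G_\beta f\in L^q(\mathbb R^d)$, and $$\|\mathcal G_\beta f\|_q\le C\,|\!|\!|f|\!|\!|_{\beta,s}.$$ (ii) For every $1<p<\infty$ there is a constant $C$ depending only on $d,p,q,s,\beta$ such that for every $f\in\mathcal L_{\beta,s}$ with $\int_{\mathbb R^d}f\,dx=0$, $$\|\mathcal G_\beta f\|_q\le C\,\|f\|_{d/(d-\beta/p')}^{1-\theta}\;|\!|\!|f|\!|\!|_{\beta,s}^{\theta},\qquad \theta=\frac{dp-\beta q}{qp}\cdot\frac{p'}{\beta+p'(s-d)},\quad p'=\frac p{p-1}.$$ Here $\|h\|_q=\big(\int_{\mathbb R^d}|h|^q\,dx\big)^{1/q}$, also when $q<1$. -/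

import Mathlib

open MeasureTheory
open scoped ENNReal NNReal

/-- The operator `𝒢_β f (x) = ∫ |x - y|^{-β} f(y) dy` on functions on `ℝ^d`. -/
noncomputable def rieszOp {d : ℕ} {𝕜 : Type*} [RCLike 𝕜] (β : ℝ)
    (f : EuclideanSpace ℝ (Fin d) → 𝕜) (x : EuclideanSpace ℝ (Fin d)) : 𝕜 :=
  ∫ y, (‖x - y‖ ^ (-β)) • f y

/-- The weak-`L^p` (Lorentz `p, ∞`) quasi-norm
`‖g‖*_{p,∞} = sup_{t ≥ 0} t |{x : |g(x)| > t}|^{1/p}`, with values in `[0, ∞]`. -/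
noncomputable def weakLpQuasiNorm {d : ℕ} (p : ℝ)
    (g : EuclideanSpace ℝ (Fin d) → ℝ) : ℝ≥0∞ :=
  ⨆ t : ℝ≥0, (t : ℝ≥0∞) * (volume {x | (t : ℝ≥0∞) < ‖g x‖ₑ}) ^ (1 / p)

/-- The Lorentz `p, 1` norm, for `1 < p < ∞`:
`‖f‖_{p,1} = sup { ∫ |f g| dx : ‖g‖*_{p',∞} ≤ 1 }`, where `p' = p / (p - 1)`. -/
noncomputable def lorentzOneNorm {d : ℕ} {𝕜 : Type*} [RCLike 𝕜] (p : ℝ)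
    (f : EuclideanSpace ℝ (Fin d) → 𝕜) : ℝ≥0∞ :=
  ⨆ (g : EuclideanSpace ℝ (Fin d) → ℝ) (_ : Measurable g)
    (_ : weakLpQuasiNorm (p / (p - 1)) g ≤ 1), ∫⁻ x, ‖f x‖ₑ * ‖g x‖ₑ

/-- The tail `f_{>R}`: `f` multiplied by the indicator of the complement of the closed ball of
radius `R` about the origin. -/
noncomputable def tailPart {d : ℕ} {𝕜 : Type*} [RCLike 𝕜] (R : ℝ)
    (f : EuclideanSpace ℝ (Fin d) → 𝕜) : EuclideanSpace ℝ (Fin d) → 𝕜 :=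
  (Metric.closedBall 0 R)ᶜ.indicator f

/-- The norm
`|||f|||_{β,s} = ∫ (1+|x|)^{s-d} |f(x)| dx + sup_{R>0} (1+R)^{β+s-d} ‖f_{>R}‖_{d/(d-β),1}`,
with values in `[0, ∞]`. -/
noncomputable def decayNorm {d : ℕ} {𝕜 : Type*} [RCLike 𝕜] (β s : ℝ)
    (f : EuclideanSpace ℝ (Fin d) → 𝕜) : ℝ≥0∞ :=
  (∫⁻ x, ENNReal.ofReal ((1 + ‖x‖) ^ (s - d)) * ‖f x‖ₑ) +
    ⨆ (R : ℝ) (_ : 0 < R), ENNReal.ofReal ((1 + R) ^ (β + s - d)) *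
      lorentzOneNorm ((d : ℝ) / (d - β)) (tailPart R f)

/-- Membership in the space `𝓛_{β,s}`: `f` is (Lebesgue) measurable and `|||f|||_{β,s} < ∞`. -/
def MemDecaySpace {d : ℕ} {𝕜 : Type*} [RCLike 𝕜] (β s : ℝ)
    (f : EuclideanSpace ℝ (Fin d) → 𝕜) : Prop :=
  AEStronglyMeasurable f volume ∧ decayNorm β s f < ∞

/-!
# Riesz potentials of functions with mean zero

Write `N` for the decay norm of `f` and `τ = β + s - d`. Everything follows from the pointwise bound
`|𝒢_β f (x)| ≤ C N (1 + |x|)^{-τ}` (`exists_enorm_rieszOp_le`). The kernel `y ↦ |x - y|^{-β}` has a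
weak `L^{d/β}` quasi-norm that does not depend on `x`, so by duality with `L_{d/(d-β),1}` the
potential of `|f|` restricted to `|y| > R` is at most `C N (1 + R)^{-τ}`; the limit `R → 0` gives
boundedness, hence absolute convergence at every `x`. For large `|x|` the constant `|x|^{-β}` may be
subtracted from the kernel, because `∫ f = 0`. Where `|y| ≤ |x| / 2`, the mean value theorem and
`0 < s - d ≤ 1` bound the difference by `C |x|^{-τ} |y|^{s-d}`, which is paid for by the weighted
`L¹` part of `N`; where `|y| > |x| / 2`, the tail bound with `R = |x| / 2` applies. Since `τ q > d`,
the pointwise bound is in `L^q`.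

For the interpolation inequality, the pointwise bound says that `𝒢_β f` is in weak `L^{d/τ}` with
norm at most `C N`, while the weak-type Hardy–Littlewood–Sobolev inequality
(`exists_meas_rieszPotential_le`) says that it is in weak `L^{dp/β}` with norm at most
`C ‖f‖_{d/(d-β/p')}`. As `d/τ < q ≤ d/β < dp/β`, the layer cake formula
(`exists_lintegral_rpow_le_of_weak`) bounds the `L^q` norm by the geometric mean of the two, and `θ`
is the exponent for which `1/q = θ τ/d + (1 - θ) β/(dp)`.
-/

/-! ### Integrals of powers of the norm -/

theorem lintegral_norm_inv_smul {d : ℕ} {F : ℝ → ℝ≥0∞} (hF : Measurable F) {δ : ℝ} (hδ : 0 < δ) :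
    ∫⁻ z : EuclideanSpace ℝ (Fin d), F (δ⁻¹ * ‖z‖) =
      ENNReal.ofReal (δ ^ d) * ∫⁻ z : EuclideanSpace ℝ (Fin d), F ‖z‖ := by
  have h1 : ∫⁻ z : EuclideanSpace ℝ (Fin d), F (δ⁻¹ * ‖z‖) =
      ∫⁻ z : EuclideanSpace ℝ (Fin d), F ‖δ⁻¹ • z‖ := by
    simp [norm_smul, abs_of_pos hδ]
  have h2 := Measure.map_addHaar_smul (volume : Measure (EuclideanSpace ℝ (Fin d)))
    (inv_ne_zero hδ.ne')
  rw [h1, ← lintegral_map (f := fun z => F ‖z‖) (g := fun z => δ⁻¹ • z) (by fun_prop) (by fun_prop),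
    h2, lintegral_smul_measure]
  simp [abs_of_pos hδ]

/-- Homogeneity: integrating `‖z‖ ^ (-γ)` over the dilate by `δ` of a radial set produces
the factor `δ ^ (d - γ)`. -/
theorem setLIntegral_norm_rpow_scale {d : ℕ} {S : Set ℝ} (hS : MeasurableSet S) (γ : ℝ) {δ : ℝ}
    (hδ : 0 < δ) :
    ∫⁻ z : EuclideanSpace ℝ (Fin d) in {z | δ⁻¹ * ‖z‖ ∈ S}, ENNReal.ofReal (‖z‖ ^ (-γ)) =
      ENNReal.ofReal (δ ^ (d - γ)) *
        ∫⁻ z : EuclideanSpace ℝ (Fin d) in {z | ‖z‖ ∈ S}, ENNReal.ofReal (‖z‖ ^ (-γ)) := by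
  have hm1 : MeasurableSet {z : EuclideanSpace ℝ (Fin d) | δ⁻¹ * ‖z‖ ∈ S} :=
    (show Measurable fun z : EuclideanSpace ℝ (Fin d) => δ⁻¹ * ‖z‖ by fun_prop) hS
  have hm2 : MeasurableSet {z : EuclideanSpace ℝ (Fin d) | ‖z‖ ∈ S} := measurable_norm hS
  have hF : Measurable (S.indicator fun u : ℝ => ENNReal.ofReal (u ^ (-γ))) :=
    Measurable.indicator (by fun_prop) hS
  have key := lintegral_norm_inv_smul (d := d) hF hδ
  rw [← lintegral_indicator hm1, ← lintegral_indicator hm2]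
  have e1 : ∀ z : EuclideanSpace ℝ (Fin d),
      {z | δ⁻¹ * ‖z‖ ∈ S}.indicator (fun z => ENNReal.ofReal (‖z‖ ^ (-γ))) z =
      ENNReal.ofReal (δ ^ (-γ)) *
        S.indicator (fun u : ℝ => ENNReal.ofReal (u ^ (-γ))) (δ⁻¹ * ‖z‖) := by
    intro z
    by_cases hz : δ⁻¹ * ‖z‖ ∈ S
    · rw [Set.indicator_of_mem (by exact hz), Set.indicator_of_mem hz,
        ← ENNReal.ofReal_mul (by positivity), ← Real.mul_rpow hδ.le (by positivity),
        mul_inv_cancel_left₀ hδ.ne']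
    · rw [Set.indicator_of_notMem (by exact hz), Set.indicator_of_notMem hz, mul_zero]
  have hFm : Measurable fun z : EuclideanSpace ℝ (Fin d) =>
      S.indicator (fun u : ℝ => ENNReal.ofReal (u ^ (-γ))) (δ⁻¹ * ‖z‖) := hF.comp (by fun_prop)
  rw [lintegral_congr e1, lintegral_const_mul _ hFm, key, ← mul_assoc,
    ← ENNReal.ofReal_mul (by positivity), ← Real.rpow_natCast, ← Real.rpow_add hδ]
  congr 3
  ring

theorem exists_setLIntegral_ball_rpow_le {d : ℕ} {β : ℝ} (hβ : 0 < β) (hβd : β < d) :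
    ∃ c : ℝ≥0, ∀ δ : ℝ, 0 < δ →
      ∫⁻ z : EuclideanSpace ℝ (Fin d) in {z | ‖z‖ < δ}, ENNReal.ofReal (‖z‖ ^ (-β)) ≤
        c * ENNReal.ofReal (δ ^ (d - β)) := by
  have hd : 0 < d := by exact_mod_cast hβ.trans hβd
  have hfin : ∫⁻ z : EuclideanSpace ℝ (Fin d) in {z | ‖z‖ ∈ Set.Iio (1 : ℝ)},
      ENNReal.ofReal (‖z‖ ^ (-β)) < ∞ := by
    have h := integrableOn_ball_of_norm_le_rpow (E := EuclideanSpace ℝ (Fin d)) (μ := volume)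
      (f := fun z => ‖z‖ ^ (-β)) (C := 1) (α := β) (r := 1) (by simpa using Nat.succ_le_of_lt hd)
      (by simpa using hβd)
      (Filter.Eventually.of_forall fun x => by
        rw [one_mul, Real.norm_of_nonneg (by positivity)])
      (by fun_prop : Measurable _).aestronglyMeasurable
    have h2 := h.lintegral_lt_top
    have hset : {z : EuclideanSpace ℝ (Fin d) | ‖z‖ ∈ Set.Iio (1 : ℝ)} = Metric.ball 0 1 := by
      ext z; simp
    rwa [hset]
  refine ⟨(∫⁻ z : EuclideanSpace ℝ (Fin d) in {z | ‖z‖ ∈ Set.Iio (1 : ℝ)},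
      ENNReal.ofReal (‖z‖ ^ (-β))).toNNReal, fun δ hδ => ?_⟩
  rw [ENNReal.coe_toNNReal hfin.ne, mul_comm,
    ← setLIntegral_norm_rpow_scale measurableSet_Iio β hδ]
  refine lintegral_mono_set fun z (hz : ‖z‖ < δ) => ?_
  simp only [Set.mem_Iio, Set.mem_ofPred_eq]
  rwa [inv_mul_lt_one₀ hδ]

theorem exists_setLIntegral_compl_ball_rpow_le {d : ℕ} {γ : ℝ} (hγ : d < γ) :
    ∃ c : ℝ≥0, ∀ δ : ℝ, 0 < δ →
      ∫⁻ z : EuclideanSpace ℝ (Fin d) in {z | δ ≤ ‖z‖}, ENNReal.ofReal (‖z‖ ^ (-γ)) ≤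
        c * ENNReal.ofReal (δ ^ (d - γ)) := by
  have hγ0 : 0 < γ := (Nat.cast_nonneg d).trans_lt hγ
  have hfin : ∫⁻ z : EuclideanSpace ℝ (Fin d) in {z | ‖z‖ ∈ Set.Ici (1 : ℝ)},
      ENNReal.ofReal (‖z‖ ^ (-γ)) < ∞ := by
    have h := finite_integral_one_add_norm (E := EuclideanSpace ℝ (Fin d)) (μ := volume)
      (r := γ) (by simpa using hγ)
    calc ∫⁻ z : EuclideanSpace ℝ (Fin d) in {z | ‖z‖ ∈ Set.Ici (1 : ℝ)},
          ENNReal.ofReal (‖z‖ ^ (-γ))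
        ≤ ∫⁻ z : EuclideanSpace ℝ (Fin d) in {z | ‖z‖ ∈ Set.Ici (1 : ℝ)},
          ENNReal.ofReal (2 ^ γ) * ENNReal.ofReal ((1 + ‖z‖) ^ (-γ)) := by
          refine setLIntegral_mono' (measurable_norm measurableSet_Ici) fun z hz => ?_
          have hz : 1 ≤ ‖z‖ := hz
          rw [← ENNReal.ofReal_mul (by positivity)]
          refine ENNReal.ofReal_le_ofReal ?_
          rw [Real.rpow_neg (by positivity), Real.rpow_neg (by positivity), ← div_eq_mul_inv,
            ← Real.div_rpow (by positivity) (by positivity), ← Real.inv_rpow (by positivity)]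
          refine Real.rpow_le_rpow (by positivity) ?_ hγ0.le
          rw [inv_eq_one_div, div_le_div_iff₀ (by positivity) (by positivity)]
          linarith
      _ ≤ ∫⁻ z : EuclideanSpace ℝ (Fin d),
          ENNReal.ofReal (2 ^ γ) * ENNReal.ofReal ((1 + ‖z‖) ^ (-γ)) := setLIntegral_le_lintegral _ _
      _ < ∞ := by
          rw [lintegral_const_mul _ (by fun_prop)]
          exact ENNReal.mul_lt_top ENNReal.ofReal_lt_top h
  refine ⟨(∫⁻ z : EuclideanSpace ℝ (Fin d) in {z | ‖z‖ ∈ Set.Ici (1 : ℝ)},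
      ENNReal.ofReal (‖z‖ ^ (-γ))).toNNReal, fun δ hδ => ?_⟩
  rw [ENNReal.coe_toNNReal hfin.ne, mul_comm,
    ← setLIntegral_norm_rpow_scale measurableSet_Ici γ hδ]
  refine lintegral_mono_set fun z (hz : δ ≤ ‖z‖) => ?_
  simp only [Set.mem_Ici, Set.mem_ofPred_eq]
  rwa [one_le_inv_mul₀ hδ]

/-! ### The weak-type Hardy–Littlewood–Sobolev inequality -/

/-- `∫ |x - y|^{-β} g(y) dy` for `g ≥ 0`, with values in `[0, ∞]`. -/
noncomputable def rieszPotential {d : ℕ} (β : ℝ) (g : EuclideanSpace ℝ (Fin d) → ℝ≥0∞)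
    (x : EuclideanSpace ℝ (Fin d)) : ℝ≥0∞ :=
  ∫⁻ y, ENNReal.ofReal (‖x - y‖ ^ (-β)) * g y

/-- The case `L¹ * Lʳ ⊆ Lʳ` of Young's inequality. -/
theorem lintegral_conv_rpow_le {d : ℕ} {k g : EuclideanSpace ℝ (Fin d) → ℝ≥0∞}
    (hk : Measurable k) (hg : Measurable g) {r : ℝ} (hr : 1 < r) :
    ∫⁻ x, (∫⁻ y, k (x - y) * g y) ^ r ≤ (∫⁻ z, k z) ^ r * ∫⁻ y, g y ^ r := by
  set J := ∫⁻ z, k z with hJ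
  obtain ⟨r', hrr⟩ : ∃ r', r.HolderConjugate r' := ⟨_, Real.HolderConjugate.conjExponent hr⟩
  have hr0 : 0 < r := hrr.pos
  have hr0' : 0 < r' := hrr.symm.pos
  have hinv : 1 / r + 1 / r' = 1 := by simpa using hrr.inv_add_inv_eq_one
  have hkJ : ∀ x, ∫⁻ y, k (x - y) = J := fun x => lintegral_sub_left_eq_self k x
  have hpt : ∀ x, (∫⁻ y, k (x - y) * g y) ^ r ≤ J ^ (r - 1) * ∫⁻ y, k (x - y) * g y ^ r := by
    intro x
    have h := ENNReal.lintegral_mul_le_Lp_mul_Lq volume hrr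
      (f := fun y => k (x - y) ^ (1 / r) * g y) (g := fun y => k (x - y) ^ (1 / r'))
      (by fun_prop) (by fun_prop)
    have e1 : ∀ y, ((fun y => k (x - y) ^ (1 / r) * g y) * fun y => k (x - y) ^ (1 / r')) y =
        k (x - y) * g y := by
      intro y
      simp only [Pi.mul_apply]
      rw [mul_right_comm, ← ENNReal.rpow_add_of_nonneg _ _ (by positivity) (by positivity), hinv,
        ENNReal.rpow_one]
    have e2 : ∀ y, (k (x - y) ^ (1 / r) * g y) ^ r = k (x - y) * g y ^ r := by
      intro y
      rw [ENNReal.mul_rpow_of_nonneg _ _ hr0.le, ← ENNReal.rpow_mul, one_div_mul_cancel hr0.ne',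
        ENNReal.rpow_one]
    have e3 : ∀ y, (k (x - y) ^ (1 / r')) ^ r' = k (x - y) := by
      intro y
      rw [← ENNReal.rpow_mul, one_div_mul_cancel hr0'.ne', ENNReal.rpow_one]
    simp only [e1, e2, e3, hkJ] at h
    calc (∫⁻ y, k (x - y) * g y) ^ r
        ≤ ((∫⁻ y, k (x - y) * g y ^ r) ^ (1 / r) * J ^ (1 / r')) ^ r :=
          ENNReal.rpow_le_rpow h hr0.le
      _ = J ^ (r - 1) * ∫⁻ y, k (x - y) * g y ^ r := by
          rw [ENNReal.mul_rpow_of_nonneg _ _ hr0.le, ← ENNReal.rpow_mul, ← ENNReal.rpow_mul,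
            one_div_mul_cancel hr0.ne', ENNReal.rpow_one, mul_comm]
          congr 2
          have : 1 / r' = 1 - 1 / r := by linarith
          rw [this]; field_simp
  calc ∫⁻ x, (∫⁻ y, k (x - y) * g y) ^ r
      ≤ ∫⁻ x, J ^ (r - 1) * ∫⁻ y, k (x - y) * g y ^ r := lintegral_mono hpt
    _ = J ^ (r - 1) * ∫⁻ x, ∫⁻ y, k (x - y) * g y ^ r := by
        rw [lintegral_const_mul _ (Measurable.lintegral_prod_right' (f := fun p : _ × _ =>
          k (p.1 - p.2) * g p.2 ^ r) (by fun_prop))]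
    _ = J ^ (r - 1) * ∫⁻ y, ∫⁻ x, k (x - y) * g y ^ r := by
        rw [lintegral_lintegral_swap (by unfold Function.uncurry; fun_prop)]
    _ = J ^ (r - 1) * ∫⁻ y, J * g y ^ r := by
        congr 1
        refine lintegral_congr fun y => ?_
        rw [lintegral_mul_const _ (by fun_prop), lintegral_sub_right_eq_self k y]
    _ = J ^ r * ∫⁻ y, g y ^ r := by
        rw [lintegral_const_mul _ (by fun_prop), ← mul_assoc]
        congr 1
        nth_rewrite 2 [← ENNReal.rpow_one J]
        rw [← ENNReal.rpow_add_of_nonneg _ _ (by linarith) zero_le_one]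
        simp

/-- Weak-type Hardy–Littlewood–Sobolev inequality: for `1 < r < d / (d - β)` the Riesz potential
maps `Lʳ` to weak `Lᵐ`, where `1 / m = 1 / r - (d - β) / d`. The target exponent is encoded by
`κ = d / m`, and the norm of `g` enters as any real `M ≥ ‖g‖_r`. The kernel is cut at a radius `δ`:
by Hölder the outer part contributes at most `t / 2` everywhere, and the inner part is integrable,
so that Young's inequality and Chebyshev's inequality bound its level set. -/
theorem exists_meas_rieszPotential_le {d : ℕ} {β r κ : ℝ} (hβ : 0 < β) (hβd : β < d)
    (hr : 1 < r) (hκ : 0 < κ) (hrκ : d / r = d - β + κ) :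
    ∃ C : ℝ, 0 < C ∧ ∀ g : EuclideanSpace ℝ (Fin d) → ℝ≥0∞, Measurable g → ∀ M : ℝ, 0 < M →
      (∫⁻ y, g y ^ r) ≤ ENNReal.ofReal (M ^ r) → ∀ t : ℝ, 0 < t →
      volume {x | ENNReal.ofReal t < rieszPotential β g x} ≤
        ENNReal.ofReal (C * (M / t) ^ (d / κ)) := by
  obtain ⟨r', hrr⟩ : ∃ r', r.HolderConjugate r' := ⟨_, Real.HolderConjugate.conjExponent hr⟩
  have hd0 : (0 : ℝ) < d := hβ.trans hβd
  have hr0 : 0 < r := hrr.pos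
  have hr0' : 0 < r' := hrr.symm.pos
  have hinv : 1 / r + 1 / r' = 1 := by simpa using hrr.inv_add_inv_eq_one
  have hdr' : d / r' = β - κ := by
    have : (d : ℝ) / r + d / r' = d := by
      rw [div_eq_mul_one_div, div_eq_mul_one_div (d : ℝ) r', ← mul_add, hinv, mul_one]
    linarith
  have hγ : d < β * r' := by
    have : (d : ℝ) = (β - κ) * r' := by rw [← hdr']; field_simp
    nlinarith
  obtain ⟨c₁, hc₁⟩ := exists_setLIntegral_ball_rpow_le hβ hβd
  obtain ⟨c₂, hc₂⟩ := exists_setLIntegral_compl_ball_rpow_le hγ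
  -- Enlarging the constants makes them positive, so that `δ` below is positive.
  set I₁ : ℝ := c₁ + 1 with hI₁
  set I₂ : ℝ := (c₂ + 1 : ℝ) ^ (1 / r') with hI₂
  have hI₁0 : 0 < I₁ := by positivity
  have hI₂0 : 0 < I₂ := by positivity
  refine ⟨(2 * I₁ * (2 * I₂) ^ ((d - β) / κ)) ^ r, by positivity, fun g hg M hM hgM t ht => ?_⟩
  -- The radius at which the Hölder bound `I₂ * δ ^ (-κ) * M` for the outer part equals `t / 2`.
  set δ : ℝ := (2 * I₂ * M / t) ^ (1 / κ) with hδ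
  have hδ0 : 0 < δ := by positivity
  have hδκ : I₂ * δ ^ (-κ) * M = t / 2 := by
    rw [hδ, ← Real.rpow_mul (by positivity), one_div_mul_eq_div, neg_div, div_self hκ.ne',
      Real.rpow_neg_one]
    field_simp
  set k : EuclideanSpace ℝ (Fin d) → ℝ≥0∞ :=
    {z | ‖z‖ < δ}.indicator fun z => ENNReal.ofReal (‖z‖ ^ (-β)) with hk
  set l : EuclideanSpace ℝ (Fin d) → ℝ≥0∞ :=
    {z | δ ≤ ‖z‖}.indicator fun z => ENNReal.ofReal (‖z‖ ^ (-β)) with hl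
  have hm1 : MeasurableSet {z : EuclideanSpace ℝ (Fin d) | ‖z‖ < δ} :=
    measurableSet_lt measurable_norm measurable_const
  have hm2 : MeasurableSet {z : EuclideanSpace ℝ (Fin d) | δ ≤ ‖z‖} :=
    measurableSet_le measurable_const measurable_norm
  have hkm : Measurable k := Measurable.indicator (by fun_prop) hm1
  have hlm : Measurable l := Measurable.indicator (by fun_prop) hm2
  have hsplit : ∀ z, ENNReal.ofReal (‖z‖ ^ (-β)) = k z + l z := by
    intro z
    rcases lt_or_ge ‖z‖ δ with h | h
    · rw [hk, hl, Set.indicator_of_mem (by exact h), Set.indicator_of_notMem (by simpa using h),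
        add_zero]
    · rw [hk, hl, Set.indicator_of_notMem (by simpa using h), Set.indicator_of_mem (by exact h),
        zero_add]
  have hfar : ∀ x, ∫⁻ y, l (x - y) * g y ≤ ENNReal.ofReal (t / 2) := by
    intro x
    have h := ENNReal.lintegral_mul_le_Lp_mul_Lq volume hrr.symm
      (f := fun y => l (x - y)) (g := g) (by fun_prop) (by fun_prop)
    have e1 : ∫⁻ y, l (x - y) ^ r' ≤ ENNReal.ofReal ((c₂ + 1) * δ ^ (d - β * r')) := by
      rw [lintegral_sub_left_eq_self (fun z => l z ^ r') x]
      have : ∀ z, l z ^ r' =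
          {z | δ ≤ ‖z‖}.indicator (fun z => ENNReal.ofReal (‖z‖ ^ (-(β * r')))) z := by
        intro z
        by_cases hz : δ ≤ ‖z‖
        · rw [hl, Set.indicator_of_mem (by exact hz), Set.indicator_of_mem (by exact hz),
            ENNReal.ofReal_rpow_of_nonneg (by positivity) hr0'.le,
            ← Real.rpow_mul (by positivity), neg_mul]
        · rw [hl, Set.indicator_of_notMem (by exact hz), Set.indicator_of_notMem (by exact hz),
            ENNReal.zero_rpow_of_pos hr0']
      rw [lintegral_congr this, lintegral_indicator hm2]
      refine (hc₂ δ hδ0).trans ?_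
      rw [← ENNReal.ofReal_coe_nnreal, ← ENNReal.ofReal_mul (by positivity)]
      refine ENNReal.ofReal_le_ofReal ?_
      gcongr
      linarith
    refine h.trans ?_
    calc (∫⁻ y, l (x - y) ^ r') ^ (1 / r') * (∫⁻ y, g y ^ r) ^ (1 / r)
        ≤ (ENNReal.ofReal ((c₂ + 1) * δ ^ (d - β * r'))) ^ (1 / r') *
          (ENNReal.ofReal (M ^ r)) ^ (1 / r) := by gcongr
      _ = ENNReal.ofReal (I₂ * δ ^ (-κ) * M) := by
          rw [ENNReal.ofReal_rpow_of_nonneg (by positivity) (by positivity),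
            ENNReal.ofReal_rpow_of_nonneg (by positivity) (by positivity),
            ← ENNReal.ofReal_mul (by positivity), ← Real.rpow_mul hM.le, mul_one_div_cancel hr0.ne',
            Real.rpow_one, Real.mul_rpow (by positivity) (by positivity),
            ← Real.rpow_mul (by positivity)]
          congr 4
          have : (d - β * r') * (1 / r') = d / r' - β := by field_simp
          rw [this, hdr']; ring
      _ = ENNReal.ofReal (t / 2) := by rw [hδκ]
  have hsub : {x | ENNReal.ofReal t < rieszPotential β g x} ⊆
      {x | ENNReal.ofReal ((t / 2) ^ r) ≤ (∫⁻ y, k (x - y) * g y) ^ r} := by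
    intro x hx
    have hx : ENNReal.ofReal t < rieszPotential β g x := hx
    have h1 : rieszPotential β g x = (∫⁻ y, k (x - y) * g y) + ∫⁻ y, l (x - y) * g y := by
      rw [← lintegral_add_left (by fun_prop)]
      simp only [rieszPotential, hsplit, add_mul]
    have h2 : ENNReal.ofReal (t / 2) ≤ ∫⁻ y, k (x - y) * g y := by
      by_contra hcon
      have hcon := not_le.1 hcon
      have : rieszPotential β g x ≤ ENNReal.ofReal t := by
        rw [h1, ← add_halves t, ENNReal.ofReal_add (by positivity) (by positivity)]
        exact add_le_add hcon.le (hfar x)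
      exact absurd hx (not_lt.2 this)
    rw [Set.mem_ofPred_eq, ← ENNReal.ofReal_rpow_of_nonneg (by positivity) hr0.le]
    exact ENNReal.rpow_le_rpow h2 hr0.le
  have hkmass : ∫⁻ z, k z ≤ ENNReal.ofReal (I₁ * δ ^ (d - β)) := by
    rw [hk, lintegral_indicator hm1]
    refine (hc₁ δ hδ0).trans ?_
    rw [← ENNReal.ofReal_coe_nnreal, ← ENNReal.ofReal_mul (by positivity)]
    refine ENNReal.ofReal_le_ofReal ?_
    gcongr
    linarith
  have hmeas : Measurable fun x => (∫⁻ y, k (x - y) * g y) ^ r :=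
    (Measurable.lintegral_prod_right' (f := fun p : _ × _ => k (p.1 - p.2) * g p.2)
      (by fun_prop)).pow_const r
  have ht2 : 0 < (t / 2) ^ r := by positivity
  calc volume {x | ENNReal.ofReal t < rieszPotential β g x}
      ≤ volume {x | ENNReal.ofReal ((t / 2) ^ r) ≤ (∫⁻ y, k (x - y) * g y) ^ r} :=
        measure_mono hsub
    _ ≤ (∫⁻ x, (∫⁻ y, k (x - y) * g y) ^ r) / ENNReal.ofReal ((t / 2) ^ r) :=
        meas_ge_le_lintegral_div hmeas.aemeasurable (by simpa using ht2) ENNReal.ofReal_ne_top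
    _ ≤ (ENNReal.ofReal (I₁ * δ ^ (d - β)) ^ r * ENNReal.ofReal (M ^ r)) /
          ENNReal.ofReal ((t / 2) ^ r) := by
        gcongr
        refine (lintegral_conv_rpow_le hkm hg hr).trans ?_
        gcongr
    _ = ENNReal.ofReal ((I₁ * δ ^ (d - β)) ^ r * M ^ r / (t / 2) ^ r) := by
        rw [ENNReal.ofReal_rpow_of_nonneg (by positivity) hr0.le,
          ← ENNReal.ofReal_mul (by positivity), ENNReal.ofReal_div_of_pos ht2]
    _ = ENNReal.ofReal ((2 * I₁ * (2 * I₂) ^ ((d - β) / κ)) ^ r * (M / t) ^ (d / κ)) := by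
        congr 1
        have hexp : d / κ = ((d - β) / κ + 1) * r := by
          have : (d : ℝ) = (d - β + κ) * r := by rw [← hrκ]; field_simp
          field_simp
          linarith
        have hδe : δ ^ (d - β) = (2 * I₂) ^ ((d - β) / κ) * (M / t) ^ ((d - β) / κ) := by
          rw [hδ, ← Real.rpow_mul (by positivity), ← Real.mul_rpow (by positivity) (by positivity)]
          congr 1
          · ring
          · ring
        rw [hexp, Real.rpow_mul (by positivity), ← Real.mul_rpow (by positivity) (by positivity),
          ← Real.mul_rpow (by positivity) (by positivity),
          ← Real.div_rpow (by positivity) (by positivity), Real.rpow_add (by positivity),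
          Real.rpow_one, hδe]
        congr 1
        field_simp

/-! ### Interpolation between weak Lebesgue spaces -/

theorem lintegral_Ioc_rpow_sub_one {s T : ℝ} (hs : 0 < s) (hT : 0 < T) :
    ∫⁻ t in Set.Ioc 0 T, ENNReal.ofReal (t ^ (s - 1)) = ENNReal.ofReal (T ^ s / s) := by
  have hint : IntegrableOn (fun t : ℝ => t ^ (s - 1)) (Set.Ioc 0 T) := by
    rw [← intervalIntegrable_iff_integrableOn_Ioc_of_le hT.le]
    exact intervalIntegral.intervalIntegrable_rpow' (by linarith)
  rw [← ofReal_integral_eq_lintegral_ofReal hint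
    ((ae_restrict_iff' measurableSet_Ioc).2 (Filter.Eventually.of_forall fun t ht =>
      Real.rpow_nonneg ht.1.le _)), ← intervalIntegral.integral_of_le hT.le,
    integral_rpow (Or.inl (by linarith))]
  simp [Real.zero_rpow hs.ne']

theorem lintegral_Ioi_rpow_neg_sub_one {s T : ℝ} (hs : 0 < s) (hT : 0 < T) :
    ∫⁻ t in Set.Ioi T, ENNReal.ofReal (t ^ (-s - 1)) = ENNReal.ofReal (T ^ (-s) / s) := by
  rw [← ofReal_integral_eq_lintegral_ofReal (integrableOn_Ioi_rpow_of_lt (by linarith) hT)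
    ((ae_restrict_iff' measurableSet_Ioi).2 (Filter.Eventually.of_forall fun t ht =>
      Real.rpow_nonneg (hT.trans ht).le _)), integral_Ioi_rpow_of_lt (by linarith) hT]
  congr 1
  rw [sub_add_cancel, neg_div_neg_eq]

/-- Interpolation: weak `Lᵃ` and weak `Lᵐ` bounds give an `L^q` bound for `a < q < m`, with the
constant of Hölder type `A ^ θ * M ^ (1 - θ)`, `1 / q = θ / a + (1 - θ) / m`. -/
theorem exists_lintegral_rpow_le_of_weak {a q m θ c₁ c₂ : ℝ} (ha : 0 < a) (haq : a < q)
    (hqm : q < m) (hθ : 1 / q = θ / a + (1 - θ) / m) (hc₁ : 0 < c₁) (hc₂ : 0 < c₂) :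
    ∃ C : ℝ, 0 < C ∧ ∀ {α : Type*} [MeasurableSpace α] (μ : Measure α) (g : α → ℝ),
      (∀ x, 0 ≤ g x) → AEMeasurable g μ → ∀ A M : ℝ, 0 < A → 0 < M →
      (∀ t, 0 < t → μ {x | t < g x} ≤ ENNReal.ofReal (c₁ * (A / t) ^ a)) →
      (∀ t, 0 < t → μ {x | t < g x} ≤ ENNReal.ofReal (c₂ * (M / t) ^ m)) →
      (∫⁻ x, ENNReal.ofReal (g x ^ q) ∂μ) ^ (1 / q) ≤
        ENNReal.ofReal (C * (A ^ θ * M ^ (1 - θ))) := by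
  have hq : 0 < q := ha.trans haq
  have hm : 0 < m := hq.trans hqm
  have hqa : 0 < q - a := sub_pos.2 haq
  have hmq : 0 < m - q := sub_pos.2 hqm
  have hma : 0 < m - a := by linarith
  refine ⟨(q * (c₁ / (q - a) + c₂ / (m - q))) ^ (1 / q), by positivity, ?_⟩
  intro α _ μ g hg hgm A M hA hM h₁ h₂
  -- `T` is the level at which the two bounds `A ^ a * t ^ (-a)` and `M ^ m * t ^ (-m)` agree.
  set T : ℝ := (M ^ m / A ^ a) ^ (1 / (m - a)) with hT
  have hT0 : 0 < T := by positivity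
  have hθ' : θ * q = a * (m - q) / (m - a) := by
    field_simp at hθ ⊢
    linear_combination (-1 : ℝ) * hθ
  have hTm : M ^ m = A ^ a * T ^ (m - a) := by
    rw [hT, ← Real.rpow_mul (by positivity), one_div_mul_cancel hma.ne', Real.rpow_one]
    field_simp
  have hTM : M ^ m * T ^ (-(m - q)) = A ^ a * T ^ (q - a) := by
    rw [hTm, mul_assoc, ← Real.rpow_add hT0]
    congr 2
    ring
  have hAM : A ^ a * T ^ (q - a) = (A ^ θ * M ^ (1 - θ)) ^ q := by
    rw [hT, ← Real.rpow_mul (by positivity), Real.div_rpow (by positivity) (by positivity),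
      ← Real.rpow_mul (by positivity), ← Real.rpow_mul (by positivity),
      Real.mul_rpow (by positivity) (by positivity), ← Real.rpow_mul (by positivity),
      ← Real.rpow_mul (by positivity), mul_div_left_comm, ← Real.rpow_sub hA, mul_comm]
    have e1 : a - a * (1 / (m - a) * (q - a)) = θ * q := by
      rw [hθ']; field_simp; ring
    have e2 : m * (1 / (m - a) * (q - a)) = (1 - θ) * q := by
      rw [sub_mul, hθ']; field_simp; ring
    rw [e1, e2, mul_comm]
  have hlow : ∫⁻ t in Set.Ioc 0 T, μ {x | t < g x} * ENNReal.ofReal (t ^ (q - 1)) ≤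
      ENNReal.ofReal (c₁ / (q - a) * (A ^ a * T ^ (q - a))) := by
    calc ∫⁻ t in Set.Ioc 0 T, μ {x | t < g x} * ENNReal.ofReal (t ^ (q - 1))
        ≤ ∫⁻ t in Set.Ioc 0 T, ENNReal.ofReal (c₁ * A ^ a) * ENNReal.ofReal (t ^ (q - a - 1)) := by
          refine setLIntegral_mono' measurableSet_Ioc fun t ht => ?_
          have ht0 : 0 < t := ht.1
          refine (mul_le_mul_left (h₁ t ht0) _).trans (le_of_eq ?_)
          rw [← ENNReal.ofReal_mul (by positivity), ← ENNReal.ofReal_mul (by positivity)]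
          congr 1
          rw [Real.div_rpow hA.le ht0.le, show q - a - 1 = (q - 1) - a by ring,
            Real.rpow_sub ht0 (q - 1)]
          field_simp
      _ = ENNReal.ofReal (c₁ / (q - a) * (A ^ a * T ^ (q - a))) := by
          rw [lintegral_const_mul _ (by fun_prop), lintegral_Ioc_rpow_sub_one hqa hT0,
            ← ENNReal.ofReal_mul (by positivity)]
          congr 1
          field_simp
  have hhigh : ∫⁻ t in Set.Ioi T, μ {x | t < g x} * ENNReal.ofReal (t ^ (q - 1)) ≤
      ENNReal.ofReal (c₂ / (m - q) * (A ^ a * T ^ (q - a))) := by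
    calc ∫⁻ t in Set.Ioi T, μ {x | t < g x} * ENNReal.ofReal (t ^ (q - 1))
        ≤ ∫⁻ t in Set.Ioi T, ENNReal.ofReal (c₂ * M ^ m) *
            ENNReal.ofReal (t ^ (-(m - q) - 1)) := by
          refine setLIntegral_mono' measurableSet_Ioi fun t ht => ?_
          have ht0 : 0 < t := hT0.trans ht
          refine (mul_le_mul_left (h₂ t ht0) _).trans (le_of_eq ?_)
          rw [← ENNReal.ofReal_mul (by positivity), ← ENNReal.ofReal_mul (by positivity)]
          congr 1
          rw [Real.div_rpow hM.le ht0.le, show -(m - q) - 1 = (q - 1) - m by ring,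
            Real.rpow_sub ht0 (q - 1)]
          field_simp
      _ = ENNReal.ofReal (c₂ / (m - q) * (A ^ a * T ^ (q - a))) := by
          rw [lintegral_const_mul _ (by fun_prop), lintegral_Ioi_rpow_neg_sub_one hmq hT0,
            ← ENNReal.ofReal_mul (by positivity), ← hTM]
          congr 1
          field_simp
  have hmain : ∫⁻ x, ENNReal.ofReal (g x ^ q) ∂μ ≤
      ENNReal.ofReal ((q * (c₁ / (q - a) + c₂ / (m - q))) * (A ^ θ * M ^ (1 - θ)) ^ q) := by
    rw [lintegral_rpow_eq_lintegral_meas_lt_mul μ (Filter.Eventually.of_forall hg) hgm hq,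
      ← Set.Ioc_union_Ioi_eq_Ioi hT0.le,
      lintegral_union measurableSet_Ioi (Set.Ioc_disjoint_Ioi le_rfl)]
    refine (mul_le_mul_right (add_le_add hlow hhigh) _).trans (le_of_eq ?_)
    rw [← ENNReal.ofReal_add (by positivity) (by positivity), ← ENNReal.ofReal_mul (by positivity),
      hAM]
    congr 1
    ring
  refine (ENNReal.rpow_le_rpow hmain (by positivity)).trans (le_of_eq ?_)
  rw [ENNReal.ofReal_rpow_of_nonneg (by positivity) (by positivity),
    Real.mul_rpow (by positivity) (by positivity), ← Real.rpow_mul (by positivity) q,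
    mul_one_div_cancel hq.ne', Real.rpow_one]

/-! ### Decay of the potential of a function with mean zero -/

/-- The Riesz kernel centred at `x` lies in weak `L^{d/β}`, uniformly in `x`. -/
theorem exists_weakLpQuasiNorm_kernel_le {d : ℕ} {β : ℝ} (hβ : 0 < β) (hβd : β < d) :
    ∃ c : ℝ, 0 < c ∧ ∀ x : EuclideanSpace ℝ (Fin d),
      weakLpQuasiNorm ((d : ℝ) / β) (fun y => c⁻¹ * ‖x - y‖ ^ (-β)) ≤ 1 := by
  have hd0 : (0 : ℝ) < d := hβ.trans hβd
  have hd : 0 < d := by exact_mod_cast hd0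
  have : Nonempty (Fin d) := ⟨⟨0, hd⟩⟩
  set v : ℝ := volume.real (Metric.ball (0 : EuclideanSpace ℝ (Fin d)) 1) with hv
  have hv0 : 0 < v := ENNReal.toReal_pos (Metric.measure_ball_pos _ _ one_pos).ne'
    measure_ball_lt_top.ne
  have hvv : volume (Metric.ball (0 : EuclideanSpace ℝ (Fin d)) 1) = ENNReal.ofReal v :=
    (ENNReal.ofReal_toReal measure_ball_lt_top.ne).symm
  refine ⟨v ^ (β / d), by positivity, fun x => iSup_le fun t => ?_⟩
  set c := v ^ (β / d) with hc
  have hc0 : 0 < c := by positivity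
  rcases eq_or_ne t 0 with rfl | ht
  · simp
  have ht0 : (0 : ℝ) < t := by positivity
  set ρ : ℝ := (c * t) ^ (-(1 / β)) with hρ
  have hρ0 : 0 < ρ := by positivity
  have hsub : {y | (t : ℝ≥0∞) < ‖c⁻¹ * ‖x - y‖ ^ (-β)‖ₑ} ⊆ Metric.ball x ρ := by
    intro y hy
    have hy : (t : ℝ≥0∞) < ‖c⁻¹ * ‖x - y‖ ^ (-β)‖ₑ := hy
    rw [Real.enorm_of_nonneg (by positivity), ← ENNReal.ofReal_coe_nnreal,
      ENNReal.ofReal_lt_ofReal_iff_of_nonneg ht0.le, lt_inv_mul_iff₀ hc0] at hy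
    rw [Metric.mem_ball, dist_comm, dist_eq_norm]
    by_contra hcon
    have hle : ρ ≤ ‖x - y‖ := not_lt.1 hcon
    have h1 : ‖x - y‖ ^ (-β) ≤ ρ ^ (-β) :=
      Real.rpow_le_rpow_of_nonpos hρ0 hle (by linarith)
    have h2 : ρ ^ (-β) = c * t := by
      rw [hρ, ← Real.rpow_mul (by positivity), neg_mul_neg, one_div_mul_cancel hβ.ne',
        Real.rpow_one]
    linarith
  calc (t : ℝ≥0∞) * volume {y | (t : ℝ≥0∞) < ‖c⁻¹ * ‖x - y‖ ^ (-β)‖ₑ} ^ (1 / ((d : ℝ) / β))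
      ≤ ENNReal.ofReal t * (ENNReal.ofReal (ρ ^ d * v)) ^ (1 / ((d : ℝ) / β)) := by
        rw [ENNReal.ofReal_coe_nnreal]
        gcongr
        refine (measure_mono hsub).trans (le_of_eq ?_)
        rw [Measure.addHaar_ball _ _ hρ0.le, hvv, ← ENNReal.ofReal_mul (by positivity)]
        simp
    _ = ENNReal.ofReal (t * (ρ ^ d * v) ^ (β / d)) := by
        rw [ENNReal.ofReal_rpow_of_nonneg (by positivity) (by positivity),
          ← ENNReal.ofReal_mul (by positivity), one_div_div]
    _ = 1 := by
        rw [Real.mul_rpow (by positivity) (by positivity), ← Real.rpow_natCast,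
          ← Real.rpow_mul hρ0.le, mul_div_cancel₀ _ hd0.ne', hρ, ← Real.rpow_mul (by positivity),
          neg_mul, one_div_mul_cancel hβ.ne', Real.rpow_neg_one, ← hc]
        field_simp
        simp

/-- Duality between `L_{d/(d-β),1}` and weak `L^{d/β}`, applied to the Riesz kernel. -/
theorem exists_rieszPotential_le_lorentzOneNorm {d : ℕ} {β : ℝ} (hβ : 0 < β) (hβd : β < d)
    (𝕜 : Type*) [RCLike 𝕜] :
    ∃ c : ℝ, 0 < c ∧ ∀ (f : EuclideanSpace ℝ (Fin d) → 𝕜) (x : EuclideanSpace ℝ (Fin d)),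
      rieszPotential β (fun y => ‖f y‖ₑ) x ≤
        ENNReal.ofReal c * lorentzOneNorm ((d : ℝ) / (d - β)) f := by
  obtain ⟨c, hc0, hc⟩ := exists_weakLpQuasiNorm_kernel_le hβ hβd
  refine ⟨c, hc0, fun f x => ?_⟩
  have hconj : (d : ℝ) / (d - β) / ((d : ℝ) / (d - β) - 1) = d / β := by
    have : (d : ℝ) - β ≠ 0 := (sub_pos.2 hβd).ne'
    rw [div_sub_one this, div_div_div_cancel_right₀ this]
    simp
  have hle : ∫⁻ y, ‖f y‖ₑ * ‖c⁻¹ * ‖x - y‖ ^ (-β)‖ₑ ≤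
      lorentzOneNorm ((d : ℝ) / (d - β)) f := by
    unfold lorentzOneNorm
    refine le_iSup_of_le (fun y => c⁻¹ * ‖x - y‖ ^ (-β)) (le_iSup_of_le (by fun_prop)
      (le_iSup_of_le ?_ le_rfl))
    rw [hconj]
    exact hc x
  calc rieszPotential β (fun y => ‖f y‖ₑ) x
      = ∫⁻ y, ENNReal.ofReal c * (‖f y‖ₑ * ‖c⁻¹ * ‖x - y‖ ^ (-β)‖ₑ) := by
        refine lintegral_congr fun y => ?_
        rw [Real.enorm_of_nonneg (by positivity), mul_left_comm, ← ENNReal.ofReal_mul hc0.le,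
          mul_inv_cancel_left₀ hc0.ne', mul_comm]
    _ = ENNReal.ofReal c * ∫⁻ y, ‖f y‖ₑ * ‖c⁻¹ * ‖x - y‖ ^ (-β)‖ₑ :=
        lintegral_const_mul' _ _ ENNReal.ofReal_ne_top
    _ ≤ _ := by gcongr

theorem lintegral_one_add_norm_rpow_mul_le_decayNorm {d : ℕ} {𝕜 : Type*} [RCLike 𝕜] (β s : ℝ)
    (f : EuclideanSpace ℝ (Fin d) → 𝕜) :
    ∫⁻ x, ENNReal.ofReal ((1 + ‖x‖) ^ (s - d)) * ‖f x‖ₑ ≤ decayNorm β s f :=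
  le_self_add

theorem lorentzOneNorm_tailPart_le {d : ℕ} {𝕜 : Type*} [RCLike 𝕜] (β s : ℝ)
    (f : EuclideanSpace ℝ (Fin d) → 𝕜) {R : ℝ} (hR : 0 < R) :
    lorentzOneNorm ((d : ℝ) / (d - β)) (tailPart R f) ≤
      ENNReal.ofReal ((1 + R) ^ (-(β + s - d))) * decayNorm β s f := by
  have h : ENNReal.ofReal ((1 + R) ^ (β + s - d)) *
      lorentzOneNorm ((d : ℝ) / (d - β)) (tailPart R f) ≤ decayNorm β s f :=
    (le_iSup₂ (f := fun (R : ℝ) (_ : 0 < R) => ENNReal.ofReal ((1 + R) ^ (β + s - d)) *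
      lorentzOneNorm ((d : ℝ) / (d - β)) (tailPart R f)) R hR).trans le_add_self
  calc lorentzOneNorm ((d : ℝ) / (d - β)) (tailPart R f)
      = ENNReal.ofReal ((1 + R) ^ (-(β + s - d))) * (ENNReal.ofReal ((1 + R) ^ (β + s - d)) *
      lorentzOneNorm ((d : ℝ) / (d - β)) (tailPart R f)) := by
        rw [← mul_assoc, ← ENNReal.ofReal_mul (by positivity), ← Real.rpow_add (by positivity)]
        simp
    _ ≤ _ := by gcongr

theorem rieszPotential_tailPart {d : ℕ} {𝕜 : Type*} [RCLike 𝕜] (β R : ℝ)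
    (f : EuclideanSpace ℝ (Fin d) → 𝕜) (x : EuclideanSpace ℝ (Fin d)) :
    rieszPotential β (fun y => ‖tailPart R f y‖ₑ) x =
      ∫⁻ y in (Metric.closedBall 0 R)ᶜ, ENNReal.ofReal (‖x - y‖ ^ (-β)) * ‖f y‖ₑ := by
  rw [← lintegral_indicator Metric.isClosed_closedBall.measurableSet.compl]
  refine lintegral_congr fun y => ?_
  by_cases hy : y ∈ (Metric.closedBall (0 : EuclideanSpace ℝ (Fin d)) R)ᶜ
  · simp only [tailPart, Set.indicator_of_mem hy]
  · simp only [tailPart, Set.indicator_of_notMem hy, enorm_zero, mul_zero]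

/-- The potential of `|f|` over `|y| > R` decays in `R`, uniformly in `x`. Letting `R → 0` (the
origin is a null set) shows that the whole potential of `|f|` is bounded. -/
theorem exists_rieszPotential_le_decayNorm {d : ℕ} {β s : ℝ} (hβ : 0 < β) (hβd : β < d)
    (hs : d < s) (𝕜 : Type*) [RCLike 𝕜] :
    ∃ c : ℝ, 0 < c ∧ ∀ (f : EuclideanSpace ℝ (Fin d) → 𝕜) (x : EuclideanSpace ℝ (Fin d)),
      rieszPotential β (fun y => ‖f y‖ₑ) x ≤ ENNReal.ofReal c * decayNorm β s f ∧
      ∀ R : ℝ, 0 < R →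
        ∫⁻ y in (Metric.closedBall 0 R)ᶜ, ENNReal.ofReal (‖x - y‖ ^ (-β)) * ‖f y‖ₑ ≤
          ENNReal.ofReal (c * (1 + R) ^ (-(β + s - d))) * decayNorm β s f := by
  obtain ⟨c, hc0, hc⟩ := exists_rieszPotential_le_lorentzOneNorm hβ hβd 𝕜
  have hd : 0 < d := by exact_mod_cast hβ.trans hβd
  have : Nonempty (Fin d) := ⟨⟨0, hd⟩⟩
  refine ⟨c, hc0, fun f x => ?_⟩
  have htail : ∀ R : ℝ, 0 < R →
        ∫⁻ y in (Metric.closedBall 0 R)ᶜ, ENNReal.ofReal (‖x - y‖ ^ (-β)) * ‖f y‖ₑ ≤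
          ENNReal.ofReal (c * (1 + R) ^ (-(β + s - d))) * decayNorm β s f := by
    intro R hR
    rw [← rieszPotential_tailPart, ENNReal.ofReal_mul hc0.le, mul_assoc]
    exact (hc _ x).trans (by gcongr; exact lorentzOneNorm_tailPart_le β s f hR)
  refine ⟨?_, htail⟩
  have hU : (⋃ n : ℕ, (Metric.closedBall (0 : EuclideanSpace ℝ (Fin d)) (1 / (n + 1 : ℝ)))ᶜ) =
      {0}ᶜ := by
    ext y
    simp only [Set.mem_iUnion, Set.mem_compl_iff, mem_closedBall_zero_iff, not_le,
      Set.mem_singleton_iff]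
    constructor
    · rintro ⟨n, hn⟩ rfl
      rw [norm_zero] at hn
      exact absurd hn (not_lt.2 (by positivity))
    · intro hy
      exact exists_nat_one_div_lt (norm_pos_iff.2 hy)
  have hdir : Directed (· ⊆ ·) fun n : ℕ =>
      (Metric.closedBall (0 : EuclideanSpace ℝ (Fin d)) (1 / (n + 1 : ℝ)))ᶜ := by
    refine Monotone.directed_le fun m n hmn => ?_
    exact Set.compl_subset_compl.2
      (Metric.closedBall_subset_closedBall (Nat.one_div_le_one_div hmn))
  have hnull : (volume : Measure (EuclideanSpace ℝ (Fin d))).restrict {0}ᶜ = volume :=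
    restrict_compl_singleton 0
  unfold rieszPotential
  rw [← hnull, ← hU, setLIntegral_iUnion_of_directed _ hdir]
  refine iSup_le fun n => (htail _ (by positivity)).trans ?_
  gcongr
  refine mul_le_of_le_one_right hc0.le (Real.rpow_le_one_of_one_le_of_nonpos ?_ (by linarith))
  simp only [le_add_iff_nonneg_right]
  positivity

/-- Mean value inequality for `w ↦ w ^ (-β)` on `[v / 2, ∞)`. -/
theorem abs_rpow_neg_sub_rpow_neg_le {β u v : ℝ} (hβ : 0 < β) (hv : 0 < v) (hu : v / 2 ≤ u) :
    |u ^ (-β) - v ^ (-β)| ≤ β * (v / 2) ^ (-β - 1) * |u - v| := by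
  have hv2 : 0 < v / 2 := by positivity
  have h := Convex.norm_image_sub_le_of_norm_hasDerivWithin_le (s := Set.Ici (v / 2))
    (f := fun w : ℝ => w ^ (-β)) (f' := fun w => -β * w ^ (-β - 1)) (x := v) (y := u)
    (C := β * (v / 2) ^ (-β - 1))
    (fun w hw => (Real.hasDerivAt_rpow_const (Or.inl (hv2.trans_le hw).ne')).hasDerivWithinAt)
    (fun w hw => by
      have hw : v / 2 ≤ w := hw
      have hw0 : 0 < w := hv2.trans_le hw
      rw [norm_mul, norm_neg, Real.norm_of_nonneg hβ.le, Real.norm_of_nonneg (by positivity)]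
      exact mul_le_mul_of_nonneg_left
        (Real.rpow_le_rpow_of_nonpos hv2 hw (by linarith)) hβ.le)
    (convex_Ici _) (by rw [Set.mem_Ici]; linarith) hu
  simpa using h

/-- Pointwise bound for the kernel with its value at `y = 0` subtracted: for `|y| ≤ |x| / 2` the
mean value theorem gains a factor `(|y| / |x|) ^ σ`, elsewhere the two terms are bounded
separately. -/
theorem abs_kernel_sub_le {E : Type*} [NormedAddCommGroup E] {β σ : ℝ} (hβ : 0 < β)
    (hσ : 0 < σ) (hσ1 : σ ≤ 1) {x : E} (hx : x ≠ 0) (y : E) :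
    |‖x - y‖ ^ (-β) - ‖x‖ ^ (-β)| ≤
      (β * 2 ^ (β + 1) + 2 ^ σ) * ‖x‖ ^ (-(β + σ)) * (1 + ‖y‖) ^ σ +
        (Metric.closedBall 0 (‖x‖ / 2))ᶜ.indicator (fun y => ‖x - y‖ ^ (-β)) y := by
  have hx0 : 0 < ‖x‖ := norm_pos_iff.2 hx
  rcases le_or_gt ‖y‖ (‖x‖ / 2) with hy | hy
  · rw [Set.indicator_of_notMem (by simpa using hy), add_zero]
    have hu : ‖x‖ / 2 ≤ ‖x - y‖ := by
      have := norm_sub_norm_le x y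
      linarith
    have hdiff : |‖x - y‖ - ‖x‖| ≤ ‖y‖ := by
      simpa using abs_norm_sub_norm_le (x - y) x
    have hyx : ‖y‖ / ‖x‖ ≤ (‖y‖ / ‖x‖) ^ σ := by
      refine Real.self_le_rpow_of_le_one (by positivity) ?_ hσ1
      rw [div_le_one hx0]
      linarith
    calc |‖x - y‖ ^ (-β) - ‖x‖ ^ (-β)|
        ≤ β * (‖x‖ / 2) ^ (-β - 1) * |‖x - y‖ - ‖x‖| := abs_rpow_neg_sub_rpow_neg_le hβ hx0 hu
      _ ≤ β * (‖x‖ / 2) ^ (-β - 1) * ‖y‖ := by gcongr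
      _ = β * 2 ^ (β + 1) * ‖x‖ ^ (-β) * (‖y‖ / ‖x‖) := by
          rw [Real.div_rpow hx0.le (by norm_num), show -β - 1 = -(β + 1) by ring,
            Real.rpow_neg zero_le_two, div_inv_eq_mul, show -(β + 1) = -β - 1 by ring,
            Real.rpow_sub_one hx0.ne']
          ring
      _ ≤ β * 2 ^ (β + 1) * ‖x‖ ^ (-β) * (‖y‖ / ‖x‖) ^ σ := by gcongr
      _ = β * 2 ^ (β + 1) * ‖x‖ ^ (-(β + σ)) * ‖y‖ ^ σ := by
          rw [Real.div_rpow (by positivity) hx0.le, neg_add, Real.rpow_add hx0,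
            Real.rpow_neg hx0.le σ]
          ring
      _ ≤ (β * 2 ^ (β + 1) + 2 ^ σ) * ‖x‖ ^ (-(β + σ)) * (1 + ‖y‖) ^ σ := by
          gcongr
          · exact le_add_of_nonneg_right (by positivity)
          · linarith
  · rw [Set.indicator_of_mem (by simpa using hy)]
    have h1 : ‖x‖ ^ (-β) ≤ (β * 2 ^ (β + 1) + 2 ^ σ) * ‖x‖ ^ (-(β + σ)) * (1 + ‖y‖) ^ σ := by
      calc ‖x‖ ^ (-β) = ‖x‖ ^ (-(β + σ)) * ‖x‖ ^ σ := by
            rw [← Real.rpow_add hx0]; congr 1; ring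
        _ ≤ ‖x‖ ^ (-(β + σ)) * (2 * (1 + ‖y‖)) ^ σ := by
            gcongr
            linarith
        _ = 2 ^ σ * ‖x‖ ^ (-(β + σ)) * (1 + ‖y‖) ^ σ := by
            rw [Real.mul_rpow (by norm_num) (by positivity)]; ring
        _ ≤ _ := by
            gcongr
            exact le_add_of_nonneg_left (by positivity)
    have h2 : 0 ≤ ‖x‖ ^ (-β) := by positivity
    have h3 : 0 ≤ ‖x - y‖ ^ (-β) := by positivity
    rw [abs_le]
    constructor <;> linarith

theorem integrable_of_memDecaySpace {d : ℕ} {𝕜 : Type*} [RCLike 𝕜] {β s : ℝ} (hs : d < s)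
    {f : EuclideanSpace ℝ (Fin d) → 𝕜} (hf : MemDecaySpace β s f) : Integrable f := by
  refine ⟨hf.1, lt_of_le_of_lt ?_ hf.2⟩
  refine le_trans (lintegral_mono fun x => ?_)
    (lintegral_one_add_norm_rpow_mul_le_decayNorm β s f)
  refine le_mul_of_one_le_left zero_le ?_
  rw [ENNReal.one_le_ofReal]
  exact Real.one_le_rpow (by simp) (by linarith)

theorem enorm_kernel_smul {d : ℕ} {𝕜 : Type*} [RCLike 𝕜] (β : ℝ)
    (x y : EuclideanSpace ℝ (Fin d)) (a : 𝕜) :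
    ‖(‖x - y‖ ^ (-β)) • a‖ₑ = ENNReal.ofReal (‖x - y‖ ^ (-β)) * ‖a‖ₑ := by
  rw [enorm_smul, Real.enorm_of_nonneg (by positivity)]

theorem integrable_kernel_smul {d : ℕ} {𝕜 : Type*} [RCLike 𝕜] {β s : ℝ} (hβ : 0 < β)
    (hβd : β < d) (hs : d < s) {f : EuclideanSpace ℝ (Fin d) → 𝕜} (hf : MemDecaySpace β s f)
    (x : EuclideanSpace ℝ (Fin d)) : Integrable fun y => (‖x - y‖ ^ (-β)) • f y := by
  obtain ⟨c, -, hc⟩ := exists_rieszPotential_le_decayNorm hβ hβd hs 𝕜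
  refine ⟨(by fun_prop : Measurable fun y : EuclideanSpace ℝ (Fin d) =>
    ‖x - y‖ ^ (-β)).aestronglyMeasurable.smul hf.1, ?_⟩
  refine lt_of_eq_of_lt (lintegral_congr fun y => enorm_kernel_smul β x y (f y)) ?_
  exact (hc f x).1.trans_lt (ENNReal.mul_lt_top ENNReal.ofReal_lt_top hf.2)

theorem enorm_rieszOp_le_rieszPotential {d : ℕ} {𝕜 : Type*} [RCLike 𝕜] (β : ℝ)
    (f : EuclideanSpace ℝ (Fin d) → 𝕜) (x : EuclideanSpace ℝ (Fin d)) :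
    ‖rieszOp β f x‖ₑ ≤ rieszPotential β (fun y => ‖f y‖ₑ) x :=
  (enorm_integral_le_lintegral_enorm _).trans
    (lintegral_mono fun y => (enorm_kernel_smul β x y (f y)).le)

theorem aestronglyMeasurable_rieszOp {d : ℕ} {𝕜 : Type*} [RCLike 𝕜] (β : ℝ)
    {f : EuclideanSpace ℝ (Fin d) → 𝕜} (hf : AEStronglyMeasurable f) :
    AEStronglyMeasurable (rieszOp β f) := by
  have h1 : rieszOp β f = rieszOp β (hf.mk f) := by
    funext x
    refine integral_congr_ae ?_
    filter_upwards [hf.ae_eq_mk] with y hy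
    rw [hy]
  rw [h1]
  refine (StronglyMeasurable.integral_prod_right (f := fun x y : EuclideanSpace ℝ (Fin d) =>
    (‖x - y‖ ^ (-β)) • hf.mk f y) ?_).aestronglyMeasurable
  refine StronglyMeasurable.smul (f := fun p : EuclideanSpace ℝ (Fin d) × _ => ‖p.1 - p.2‖ ^ (-β))
    (by fun_prop : Measurable _).stronglyMeasurable ?_
  exact hf.stronglyMeasurable_mk.comp_measurable measurable_snd

/-- Decay of the potential: since `∫ f = 0`, the value `|x|^{-β}` of the kernel at `y = 0` may be
subtracted, which improves the decay from `|x|^{-β}` to `|x|^{-(β + s - d)}`. -/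
theorem exists_enorm_rieszOp_le {d : ℕ} {β s : ℝ} (hβ : 0 < β) (hβd : β < d)
    (hs : d < s) (hs' : s ≤ d + 1) (𝕜 : Type*) [RCLike 𝕜] :
    ∃ C : ℝ, 0 < C ∧ ∀ f : EuclideanSpace ℝ (Fin d) → 𝕜, MemDecaySpace β s f → ∫ x, f x = 0 →
      ∀ x, ‖rieszOp β f x‖ₑ ≤
        ENNReal.ofReal (C * (1 + ‖x‖) ^ (-(β + s - d))) * decayNorm β s f := by
  obtain ⟨c, hc0, hc⟩ := exists_rieszPotential_le_decayNorm hβ hβd hs 𝕜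
  set τ : ℝ := β + s - d with hτ
  have hτ0 : 0 < τ := by linarith
  set K : ℝ := β * 2 ^ (β + 1) + 2 ^ (s - d) with hK
  have hK0 : 0 < K := by positivity
  have half : ∀ a : ℝ, 0 < a → (a / 2) ^ (-τ) = 2 ^ τ * a ^ (-τ) := by
    intro a ha
    rw [Real.div_rpow ha.le zero_le_two, Real.rpow_neg zero_le_two, div_inv_eq_mul, mul_comm]
  refine ⟨(K + c) * 2 ^ τ, by positivity, fun f hf hf0 x => ?_⟩
  -- Near the origin the uniform bound suffices; cancellation matters only for `1 ≤ ‖x‖`.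
  rcases lt_or_ge ‖x‖ 1 with hx | hx
  · refine (enorm_rieszOp_le_rieszPotential β f x).trans ((hc f x).1.trans ?_)
    gcongr
    have : (1 : ℝ) ≤ 2 ^ τ * (1 + ‖x‖) ^ (-τ) := by
      rw [← half _ (by positivity)]
      exact Real.one_le_rpow_of_pos_of_le_one_of_nonpos (by positivity) (by linarith) (by linarith)
    rw [mul_assoc]
    nlinarith
  have hx0 : x ≠ 0 := norm_pos_iff.1 (by linarith)
  have hrep : rieszOp β f x = ∫ y, (‖x - y‖ ^ (-β) - ‖x‖ ^ (-β)) • f y := by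
    simp_rw [sub_smul]
    have hint : Integrable fun y => ‖x‖ ^ (-β) • f y :=
      (integrable_of_memDecaySpace hs hf).smul (‖x‖ ^ (-β))
    rw [integral_sub (integrable_kernel_smul hβ hβd hs hf x) hint, integral_smul, hf0, smul_zero,
      sub_zero, rieszOp]
  have hpt : ∀ y, ‖(‖x - y‖ ^ (-β) - ‖x‖ ^ (-β)) • f y‖ₑ ≤
      ENNReal.ofReal (K * ‖x‖ ^ (-τ)) * (ENNReal.ofReal ((1 + ‖y‖) ^ (s - d)) * ‖f y‖ₑ) +
      (Metric.closedBall 0 (‖x‖ / 2))ᶜ.indicator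
        (fun y => ENNReal.ofReal (‖x - y‖ ^ (-β)) * ‖f y‖ₑ) y := by
    intro y
    have h := abs_kernel_sub_le hβ (sub_pos.2 hs) (by linarith) hx0 y
    rw [show β + (s - d) = τ by rw [hτ]; ring, ← hK] at h
    have hind : (Metric.closedBall 0 (‖x‖ / 2))ᶜ.indicator
        (fun y => ENNReal.ofReal (‖x - y‖ ^ (-β)) * ‖f y‖ₑ) y =
        ENNReal.ofReal ((Metric.closedBall 0 (‖x‖ / 2))ᶜ.indicator
          (fun y => ‖x - y‖ ^ (-β)) y) * ‖f y‖ₑ := by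
      by_cases hy : y ∈ (Metric.closedBall (0 : EuclideanSpace ℝ (Fin d)) (‖x‖ / 2))ᶜ
      · rw [Set.indicator_of_mem hy, Set.indicator_of_mem hy]
      · rw [Set.indicator_of_notMem hy, Set.indicator_of_notMem hy]
        simp
    rw [hind, ← mul_assoc, ← ENNReal.ofReal_mul (by positivity), ← add_mul,
      ← ENNReal.ofReal_add (by positivity) (Set.indicator_nonneg (fun _ _ => by positivity) _),
      enorm_smul, Real.enorm_eq_ofReal_abs]
    gcongr
  calc ‖rieszOp β f x‖ₑ
      ≤ ∫⁻ y, ‖(‖x - y‖ ^ (-β) - ‖x‖ ^ (-β)) • f y‖ₑ := by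
        rw [hrep]; exact enorm_integral_le_lintegral_enorm _
    _ ≤ ENNReal.ofReal (K * ‖x‖ ^ (-τ)) * (∫⁻ y, ENNReal.ofReal ((1 + ‖y‖) ^ (s - d)) * ‖f y‖ₑ) +
        ∫⁻ y in (Metric.closedBall 0 (‖x‖ / 2))ᶜ, ENNReal.ofReal (‖x - y‖ ^ (-β)) * ‖f y‖ₑ := by
        refine (lintegral_mono hpt).trans (le_of_eq ?_)
        rw [lintegral_add_left', lintegral_const_mul' _ _ ENNReal.ofReal_ne_top,
          lintegral_indicator Metric.isClosed_closedBall.measurableSet.compl]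
        have := hf.1.enorm
        fun_prop
    _ ≤ ENNReal.ofReal (K * ‖x‖ ^ (-τ)) * decayNorm β s f +
        ENNReal.ofReal (c * (1 + ‖x‖ / 2) ^ (-τ)) * decayNorm β s f := by
        gcongr
        · exact lintegral_one_add_norm_rpow_mul_le_decayNorm β s f
        · exact (hc f x).2 _ (by positivity)
    _ = ENNReal.ofReal (K * ‖x‖ ^ (-τ) + c * (1 + ‖x‖ / 2) ^ (-τ)) * decayNorm β s f := by
        rw [← add_mul, ENNReal.ofReal_add (by positivity) (by positivity)]
    _ ≤ _ := by
        gcongr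
        have h1 : ‖x‖ ^ (-τ) ≤ 2 ^ τ * (1 + ‖x‖) ^ (-τ) := by
          rw [← half _ (by positivity)]
          exact Real.rpow_le_rpow_of_nonpos (by positivity) (by linarith) (by linarith)
        have h2 : (1 + ‖x‖ / 2) ^ (-τ) ≤ 2 ^ τ * (1 + ‖x‖) ^ (-τ) := by
          rw [← half _ (by positivity)]
          exact Real.rpow_le_rpow_of_nonpos (by positivity) (by linarith) (by linarith)
        nlinarith

/-! ### The `L^q` bounds -/

/-- For `0 < q`, including `q < 1`. -/
theorem eLpNorm_ofReal_eq_lintegral {α E : Type*} [MeasurableSpace α] {μ : Measure α}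
    [NormedAddCommGroup E] {q : ℝ} (hq : 0 < q) (g : α → E) :
    eLpNorm g (ENNReal.ofReal q) μ = (∫⁻ x, ‖g x‖ₑ ^ q ∂μ) ^ (1 / q) := by
  rw [eLpNorm_eq_lintegral_rpow_enorm_toReal (by simpa using hq) ENNReal.ofReal_ne_top,
    ENNReal.toReal_ofReal hq.le]

/-- Integrating the pointwise bound `(1 + |x|) ^ (-(β + s - d))`, whose `q`-th power is integrable
because `(β + s - d) q > d`. -/
theorem exists_eLpNorm_rieszOp_le {d : ℕ} {β s q : ℝ} (hβ : 0 < β) (hβd : β < d)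
    (hs : d < s) (hs' : s ≤ d + 1) (hq : (d : ℝ) / (β + s - d) < q) (𝕜 : Type*) [RCLike 𝕜] :
    ∃ C : ℝ≥0, ∀ f : EuclideanSpace ℝ (Fin d) → 𝕜, MemDecaySpace β s f → ∫ x, f x = 0 →
      eLpNorm (rieszOp β f) (ENNReal.ofReal q) volume ≤ C * decayNorm β s f := by
  have hτ0 : 0 < β + s - d := by linarith
  have hq0 : 0 < q := lt_of_le_of_lt (by positivity) hq
  obtain ⟨C, hC0, hC⟩ := exists_enorm_rieszOp_le hβ hβd hs hs' 𝕜
  have hfin := finite_integral_one_add_norm (E := EuclideanSpace ℝ (Fin d)) (μ := volume)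
    (r := (β + s - d) * q) (by
      rw [div_lt_iff₀ hτ0] at hq
      simpa [mul_comm] using hq)
  set J := ∫⁻ x : EuclideanSpace ℝ (Fin d),
    ENNReal.ofReal ((1 + ‖x‖) ^ (-((β + s - d) * q))) with hJ
  have hJ' : J ^ (1 / q) ≠ ∞ := ENNReal.rpow_ne_top_of_nonneg (by positivity) hfin.ne
  refine ⟨C.toNNReal * (J ^ (1 / q)).toNNReal, fun f hf hf0 => ?_⟩
  rw [eLpNorm_ofReal_eq_lintegral hq0]
  set N := decayNorm β s f with hN
  have hpt : ∀ x, ‖rieszOp β f x‖ₑ ^ q ≤ (ENNReal.ofReal C * N) ^ q *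
      ENNReal.ofReal ((1 + ‖x‖) ^ (-((β + s - d) * q))) := by
    intro x
    refine (ENNReal.rpow_le_rpow (hC f hf hf0 x) hq0.le).trans (le_of_eq ?_)
    rw [ENNReal.ofReal_mul hC0.le, mul_right_comm, ENNReal.mul_rpow_of_nonneg _ _ hq0.le,
      ENNReal.ofReal_rpow_of_nonneg (by positivity) hq0.le, ← Real.rpow_mul (by positivity),
      neg_mul]
  calc (∫⁻ x, ‖rieszOp β f x‖ₑ ^ q) ^ (1 / q)
      ≤ ((ENNReal.ofReal C * N) ^ q * J) ^ (1 / q) := by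
        gcongr
        exact (lintegral_mono hpt).trans
          (le_of_eq (lintegral_const_mul _ (by fun_prop)))
    _ = ENNReal.ofReal C * N * J ^ (1 / q) := by
        rw [ENNReal.mul_rpow_of_nonneg _ _ (by positivity), ← ENNReal.rpow_mul,
          mul_one_div_cancel hq0.ne', ENNReal.rpow_one]
    _ = _ := by
        rw [ENNReal.coe_mul, ENNReal.coe_toNNReal hJ', mul_right_comm]
        rfl

/-- Weak `L^{d/(β+s-d)}` bound for the potential: its level sets lie in balls, by the pointwise
decay. -/
theorem exists_meas_norm_rieszOp_le_of_decayNorm {d : ℕ} {β s : ℝ} (hβ : 0 < β) (hβd : β < d)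
    (hs : d < s) (hs' : s ≤ d + 1) (𝕜 : Type*) [RCLike 𝕜] :
    ∃ C : ℝ, 0 < C ∧ ∀ f : EuclideanSpace ℝ (Fin d) → 𝕜, MemDecaySpace β s f → ∫ x, f x = 0 →
      ∀ N : ℝ, 0 < N → decayNorm β s f = ENNReal.ofReal N → ∀ t : ℝ, 0 < t →
        volume {x | t < ‖rieszOp β f x‖} ≤
          ENNReal.ofReal (C * (N / t) ^ ((d : ℝ) / (β + s - d))) := by
  have hd : 0 < d := by exact_mod_cast hβ.trans hβd
  have : Nonempty (Fin d) := ⟨⟨0, hd⟩⟩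
  obtain ⟨C, hC0, hC⟩ := exists_enorm_rieszOp_le hβ hβd hs hs' 𝕜
  set τ : ℝ := β + s - d with hτ
  have hτ0 : 0 < τ := by linarith
  set v : ℝ := volume.real (Metric.ball (0 : EuclideanSpace ℝ (Fin d)) 1) with hv
  have hv0 : 0 < v := ENNReal.toReal_pos (Metric.measure_ball_pos _ _ one_pos).ne'
    measure_ball_lt_top.ne
  have hvv : volume (Metric.ball (0 : EuclideanSpace ℝ (Fin d)) 1) = ENNReal.ofReal v :=
    (ENNReal.ofReal_toReal measure_ball_lt_top.ne).symm
  refine ⟨v * C ^ ((d : ℝ) / τ), by positivity, fun f hf hf0 N hN hfN t ht => ?_⟩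
  set ρ : ℝ := (C * N / t) ^ (1 / τ) with hρ
  have hρ0 : 0 < ρ := by positivity
  have hsub : {x | t < ‖rieszOp β f x‖} ⊆ Metric.ball 0 ρ := by
    intro x hx
    have hx : t < ‖rieszOp β f x‖ := hx
    have h1 := hC f hf hf0 x
    rw [hfN, ← ENNReal.ofReal_mul (by positivity), ← ofReal_norm,
      ENNReal.ofReal_le_ofReal_iff (by positivity)] at h1
    have h2 := hx.trans_le h1
    have h3 : (1 + ‖x‖) ^ τ < C * N / t := by
      rw [Real.rpow_neg (by positivity)] at h2
      rw [lt_div_iff₀ ht]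
      have hp : 0 < (1 + ‖x‖) ^ τ := by positivity
      calc (1 + ‖x‖) ^ τ * t < (1 + ‖x‖) ^ τ * (C * ((1 + ‖x‖) ^ τ)⁻¹ * N) := by gcongr
        _ = C * N := by field_simp
    have h4 : 1 + ‖x‖ < ρ := by
      have := Real.rpow_lt_rpow (by positivity) h3 (show 0 < 1 / τ by positivity)
      rwa [← Real.rpow_mul (by positivity), mul_one_div_cancel hτ0.ne', Real.rpow_one] at this
    rw [mem_ball_zero_iff]
    linarith
  refine (measure_mono hsub).trans (le_of_eq ?_)
  rw [Measure.addHaar_ball _ _ hρ0.le, hvv, ← ENNReal.ofReal_mul (by positivity),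
    finrank_euclideanSpace, Fintype.card_fin, ← Real.rpow_natCast, hρ,
    ← Real.rpow_mul (by positivity), one_div_mul_eq_div, mul_div_assoc,
    Real.mul_rpow (by positivity) (by positivity)]
  congr 1
  ring

theorem exists_meas_norm_rieszOp_le_of_eLpNorm {d : ℕ} {β r κ : ℝ} (hβ : 0 < β) (hβd : β < d)
    (hr : 1 < r) (hκ : 0 < κ) (hrκ : d / r = d - β + κ) (𝕜 : Type*) [RCLike 𝕜] :
    ∃ C : ℝ, 0 < C ∧ ∀ f : EuclideanSpace ℝ (Fin d) → 𝕜, AEStronglyMeasurable f →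
      ∀ M : ℝ, 0 < M → eLpNorm f (ENNReal.ofReal r) volume = ENNReal.ofReal M →
      ∀ t : ℝ, 0 < t → volume {x | t < ‖rieszOp β f x‖} ≤
        ENNReal.ofReal (C * (M / t) ^ (d / κ)) := by
  have hr0 : 0 < r := one_pos.trans hr
  obtain ⟨C, hC0, hC⟩ := exists_meas_rieszPotential_le hβ hβd hr hκ hrκ
  refine ⟨C, hC0, fun f hf M hM hfM t ht => ?_⟩
  have hg : Measurable fun y => ‖hf.mk f y‖ₑ := hf.stronglyMeasurable_mk.enorm
  have hgM : ∫⁻ y, ‖hf.mk f y‖ₑ ^ r ≤ ENNReal.ofReal (M ^ r) := by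
    rw [eLpNorm_congr_ae hf.ae_eq_mk, eLpNorm_ofReal_eq_lintegral hr0] at hfM
    rw [← ENNReal.ofReal_rpow_of_nonneg hM.le hr0.le, ← hfM, ← ENNReal.rpow_mul,
      one_div_mul_cancel hr0.ne', ENNReal.rpow_one]
  refine (measure_mono fun x hx => ?_).trans (hC _ hg M hM hgM t ht)
  have hx : t < ‖rieszOp β f x‖ := hx
  have h1 : rieszPotential β (fun y => ‖f y‖ₑ) x =
      rieszPotential β (fun y => ‖hf.mk f y‖ₑ) x := by
    refine lintegral_congr_ae ?_
    filter_upwards [hf.ae_eq_mk] with y hy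
    rw [hy]
  refine lt_of_lt_of_le ?_ ((enorm_rieszOp_le_rieszPotential β f x).trans h1.le)
  rw [← ofReal_norm]
  exact (ENNReal.ofReal_lt_ofReal_iff_of_nonneg ht.le).2 hx

/-- The interpolation inequality, between weak `L^{d/(β+s-d)}` (pointwise decay) and weak
`L^{dp/β}` (Hardy–Littlewood–Sobolev). The interpolation lemma needs positive finite norms, so the
degenerate values `0` and `∞` are treated separately. -/
theorem exists_eLpNorm_rieszOp_le_interpolation {d : ℕ} {β s q p p' θ : ℝ} (hβ : 0 < β)
    (hβd : β < d) (hs : d < s) (hs' : s ≤ d + 1) (hq : (d : ℝ) / (β + s - d) < q)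
    (hq' : q ≤ (d : ℝ) / β) (hp : 1 < p) (hp' : p' = p / (p - 1))
    (hθ : θ = (d * p - β * q) / (q * p) * (p' / (β + p' * (s - d)))) (𝕜 : Type*) [RCLike 𝕜] :
    ∃ C : ℝ≥0, ∀ f : EuclideanSpace ℝ (Fin d) → 𝕜,
      MemDecaySpace β s f → ∫ x, f x = 0 →
        eLpNorm (rieszOp β f) (ENNReal.ofReal q) volume ≤
          C * ((eLpNorm f (ENNReal.ofReal ((d : ℝ) / (d - β / p'))) volume) ^ (1 - θ) *
            (decayNorm β s f) ^ θ) := by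
  have hd0 : (0 : ℝ) < d := hβ.trans hβd
  have hp0 : 0 < p := one_pos.trans hp
  have hp1 : 0 < p - 1 := sub_pos.2 hp
  set τ : ℝ := β + s - d with hτ
  have hτβ : β < τ := by linarith
  have hτ0 : 0 < τ := by linarith
  have hq0 : 0 < q := lt_of_le_of_lt (by positivity) hq
  have hβp' : β / p' = β - β / p := by rw [hp']; field_simp
  set κ : ℝ := β / p with hκ
  have hκ0 : 0 < κ := by positivity
  have hκβ : κ < β := div_lt_self hβ hp
  set r : ℝ := (d : ℝ) / (d - β / p') with hr
  have hr1 : 1 < r := by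
    rw [hr, hβp', one_lt_div (by linarith)]
    linarith
  have hrκ : (d : ℝ) / r = d - β + κ := by
    rw [hr, div_div_cancel₀ hd0.ne', hβp']
    ring
  have hqm : q < d / κ := hq'.trans_lt (div_lt_div_of_pos_left hd0 hκ0 hκβ)
  have hD : 0 < p * τ - β := by nlinarith
  have hθ' : θ = (d * p - β * q) / (q * (p * τ - β)) := by
    have : p' / (β + p' * (s - d)) = p / (p * τ - β) := by
      have e : β + p / (p - 1) * (s - d) = (p * τ - β) / (p - 1) := by
        rw [hτ]; field_simp; ring
      rw [hp', e, div_div_div_cancel_right₀ hp1.ne']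
    rw [hθ, this]
    field_simp
  have hθ1 : 1 / q = θ / (d / τ) + (1 - θ) / (d / κ) := by
    rw [hθ', hκ]
    field_simp
    ring
  have hθlt : 0 < 1 - θ := by
    rw [hθ', sub_pos, div_lt_one (by positivity)]
    rw [div_lt_iff₀ hτ0] at hq
    nlinarith
  obtain ⟨c₁, hc₁, h₁⟩ := exists_meas_norm_rieszOp_le_of_decayNorm hβ hβd hs hs' 𝕜
  obtain ⟨c₂, hc₂, h₂⟩ := exists_meas_norm_rieszOp_le_of_eLpNorm hβ hβd hr1 hκ0 hrκ 𝕜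
  obtain ⟨C, hC0, hC⟩ := exists_lintegral_rpow_le_of_weak (by positivity) hq hqm hθ1 hc₁ hc₂
  refine ⟨C.toNNReal, fun f hf hf0 => ?_⟩
  have hzero : rieszOp β f = 0 → eLpNorm (rieszOp β f) (ENNReal.ofReal q) volume ≤
      C.toNNReal * (eLpNorm f (ENNReal.ofReal r) volume ^ (1 - θ) * decayNorm β s f ^ θ) := by
    intro h
    rw [h, eLpNorm_zero]
    exact zero_le
  rcases eq_or_ne (decayNorm β s f) 0 with hN | hN
  · obtain ⟨K, -, hK⟩ := exists_enorm_rieszOp_le hβ hβd hs hs' 𝕜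
    refine hzero (funext fun x => ?_)
    have := hK f hf hf0 x
    rwa [hN, mul_zero, nonpos_iff_eq_zero, enorm_eq_zero] at this
  rcases eq_or_ne (eLpNorm f (ENNReal.ofReal r) volume) 0 with hM | hM
  · rw [eLpNorm_eq_zero_iff hf.1 (by simpa using one_pos.trans hr1)] at hM
    refine hzero (funext fun x => ?_)
    refine integral_eq_zero_of_ae ?_
    filter_upwards [hM] with y hy
    simp [hy]
  rcases eq_or_ne (eLpNorm f (ENNReal.ofReal r) volume) ∞ with hM' | hM'
  · rw [hM', ENNReal.top_rpow_of_pos hθlt,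
      ENNReal.top_mul (ENNReal.rpow_pos (pos_iff_ne_zero.2 hN) hf.2.ne).ne',
      ENNReal.mul_top (by simpa using hC0)]
    exact le_top
  have hN0 := ENNReal.toReal_pos hN hf.2.ne
  have hM0 := ENNReal.toReal_pos hM hM'
  have hNr := (ENNReal.ofReal_toReal hf.2.ne).symm
  have hMr := (ENNReal.ofReal_toReal hM').symm
  have key := hC volume (fun x => ‖rieszOp β f x‖) (fun x => norm_nonneg _)
    (aestronglyMeasurable_rieszOp β hf.1).norm.aemeasurable _ _ hN0 hM0
    (h₁ f hf hf0 _ hN0 hNr) (h₂ f hf.1 _ hM0 hMr)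
  rw [eLpNorm_ofReal_eq_lintegral hq0]
  have e : ∀ x, ‖rieszOp β f x‖ₑ ^ q = ENNReal.ofReal (‖rieszOp β f x‖ ^ q) := fun x => by
    rw [← ofReal_norm, ENNReal.ofReal_rpow_of_nonneg (norm_nonneg _) hq0.le]
  rw [lintegral_congr e]
  refine key.trans (le_of_eq ?_)
  rw [ENNReal.ofReal_mul hC0.le, ENNReal.ofReal_mul (by positivity),
    ← ENNReal.ofReal_rpow_of_pos hN0, ← ENNReal.ofReal_rpow_of_pos hM0, ← hNr, ← hMr,
    mul_comm (decayNorm β s f ^ θ)]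
  rfl

theorem theorem1p6 {𝕜 : Type*} [RCLike 𝕜] (d : ℕ) (β s q : ℝ)
    (hβ : 0 < β) (hβd : β < d) (hs : (d : ℝ) < s) (hs' : s ≤ d + 1)
    (hq : (d : ℝ) / (β + s - d) < q) (hq' : q ≤ (d : ℝ) / β) :
    (∃ C : ℝ≥0, ∀ f : EuclideanSpace ℝ (Fin d) → 𝕜,
      MemDecaySpace β s f → ∫ x, f x = 0 →
        (∀ᵐ x, Integrable (fun y => (‖x - y‖ ^ (-β)) • f y)) ∧
        MemLp (rieszOp β f) (ENNReal.ofReal q) volume ∧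
        eLpNorm (rieszOp β f) (ENNReal.ofReal q) volume ≤ C * decayNorm β s f) ∧
    (∀ p p' θ : ℝ, 1 < p → p' = p / (p - 1) →
      θ = (d * p - β * q) / (q * p) * (p' / (β + p' * (s - d))) →
      ∃ C : ℝ≥0, ∀ f : EuclideanSpace ℝ (Fin d) → 𝕜,
        MemDecaySpace β s f → ∫ x, f x = 0 →
          eLpNorm (rieszOp β f) (ENNReal.ofReal q) volume ≤
            C * ((eLpNorm f (ENNReal.ofReal ((d : ℝ) / (d - β / p'))) volume) ^ (1 - θ) *
              (decayNorm β s f) ^ θ)) := by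
  refine ⟨?_, fun p p' θ hp hp' hθ =>
    exists_eLpNorm_rieszOp_le_interpolation hβ hβd hs hs' hq hq' hp hp' hθ 𝕜⟩
  obtain ⟨C, hC⟩ := exists_eLpNorm_rieszOp_le hβ hβd hs hs' hq 𝕜
  refine ⟨C, fun f hf hf0 => ⟨Filter.Eventually.of_forall fun x =>
    integrable_kernel_smul hβ hβd hs hf x, ⟨aestronglyMeasurable_rieszOp β hf.1, ?_⟩,
    hC f hf hf0⟩⟩
  exact (hC f hf hf0).trans_lt (ENNReal.mul_lt_top ENNReal.coe_lt_top hf.2)
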